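/- **Theorem (existence and uniqueness of equilibrium).** Let $n\in\mathbb{N}$, let $A,c,d>0$, $b\ge 0$ and $K_{ex}\ge 0$ be real numbers, and for each firm $i\in\{1,\dots,n\}$ let $\mu_i$ (the belief of firm $i$ about the distribution of the climate response $\alpha$) be a probability measure on $\mathbb{R}$ with finite second moment $\alpha_i^2:=E_i[\alpha^2]=\int \alpha^2\,\mu_i(d\alpha)<\infty$; the case $\alpha_i^2=0$ is allowed. Consumers have the quadratic utility $u(x)=-\frac12(A-x)^2$ for $0\le x\le A$ and $u(x)=0$ for $x>A$, so that the inverse demand is $u'(x)=(A-x)^+$. Each firm $i$ chooses a technology $r_i\in[0,1]$ and a quantity $q_i\in[0,\infty)$, with the convention that $r_i=0$ when $q_i=0$. Given $Q_{-i}=\sum_{j\ne i}q_j$ and $K_{-i}=K_{ex}+\sum_{j\neq i}r_jq_j$, the profit of firm $i$ for the choice $(r,q)$ is $$\pi_i(r,q)=(A-q-Q_{-i})^+\,q-b\,\alpha^2\,(rq+K_{-i})\,rq-[c+(1-r)d]\,q ,$$ and its expected profit under its belief is $$E_i[\pi_i(r,q)]=(A-q-Q_{-i})^+\,q-b\,\alpha_i^2\,(rq+K_{-i})\,rq-[c+(1-r)d]\,q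 .$$ A profile $(r_j,q_j)_{1\le j\le n}$ is a Nash equilibrium if, for every $i$, $(r_i,q_i)$ maximizes $E_i[\pi_i(r,q)]$ over $(r,q)\in[0,1]\times[0,\infty)$ given $Q_{-i}$ and $K_{-i}$. Then there exists exactly one Nash equilibrium $(r_j,q_j)_{1\le j\le n}$. -/

import Mathlib

open MeasureTheory

/-- The quadratic consumer utility: `u(x) = -(A - x)² / 2` for `x ≤ A` and `u(x) = 0` for
`x > A`. -/
noncomputable def consumerUtility (A x : ℝ) : ℝ :=
  if x ≤ A then -(1 / 2) * (A - x) ^ 2 else 0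

/-- The inverse demand `u'(x) = (A - x)⁺`, that is, the unit price paid by the consumers when
the total supply is `x`. -/
def inverseDemand (A x : ℝ) : ℝ :=
  max (A - x) 0

/-- The inverse demand is the marginal utility. -/
theorem hasDerivAt_consumerUtility (A x : ℝ) :
    HasDerivAt (consumerUtility A) (inverseDemand A x) x := by
  have h1 : consumerUtility A = fun y => -(1 / 2) * (max (A - y) 0) ^ 2 := by
    funext y
    unfold consumerUtility
    split_ifs with h
    · rw [max_eq_left (by linarith)]
    · rw [max_eq_right (by linarith)]; simp
  have hq : ∀ y : ℝ, HasDerivAt (fun y : ℝ => -(1 / 2) * (A - y) ^ 2) (A - y) y := by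
    intro y
    have := ((((hasDerivAt_id y).const_sub A).pow 2).const_mul (-(1 / 2) : ℝ))
    refine this.congr_deriv ?_
    simp only [id]
    ring
  unfold inverseDemand
  rcases lt_trichotomy x A with h | h | h
  · rw [max_eq_left (by linarith)]
    refine (hq x).congr_of_eventuallyEq ?_
    filter_upwards [Iio_mem_nhds h] with y hy
    rw [h1]
    simp only [max_eq_left (sub_nonneg.mpr (le_of_lt (Set.mem_Iio.mp hy)))]
  · subst h
    rw [sub_self, max_self, hasDerivAt_iff_isLittleO_nhds_zero]
    rw [Asymptotics.isLittleO_iff]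
    intro ε hε
    filter_upwards [Metric.ball_mem_nhds (0 : ℝ) hε] with t ht
    rw [Metric.mem_ball, dist_zero_right, Real.norm_eq_abs] at ht
    rw [h1]
    simp only [sub_self, max_self, smul_zero, sub_zero, Real.norm_eq_abs]
    have e : x - (x + t) = -t := by ring
    rw [e]
    have hm : max (-t) 0 ≤ |t| := max_le (neg_le_abs t) (abs_nonneg t)
    have hm0 : 0 ≤ max (-t) 0 := le_max_right _ _
    have hz : -(1 / 2 : ℝ) * (0 : ℝ) ^ 2 = 0 := by norm_num
    rw [hz, sub_zero, abs_mul, abs_of_nonneg (sq_nonneg (max (-t) 0))]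
    have h2 : |(-(1 / 2) : ℝ)| = 1 / 2 := by norm_num
    rw [h2]
    nlinarith [abs_nonneg t]
  · rw [max_eq_right (by linarith)]
    refine (hasDerivAt_const x (0 : ℝ)).congr_of_eventuallyEq ?_
    filter_upwards [Ioi_mem_nhds h] with y hy
    rw [h1]
    simp only [max_eq_right (sub_nonpos.mpr (le_of_lt (Set.mem_Ioi.mp hy)))]
    norm_num

/-- The parameters of the Cournot model with `n` firms. -/
structure CournotModel (n : ℕ) where
  /-- demand parameter of the quadratic utility -/
  A : ℝ
  /-- unit cost of the technology with the highest emission (`r = 1`) -/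
  c : ℝ
  /-- unit cost premium of the emission-free technology (`r = 0`) -/
  d : ℝ
  /-- tax coefficient: the tax rate is `b` times the temperature increase -/
  b : ℝ
  /-- exogenous amount of carbon -/
  Kex : ℝ
  /-- `belief i` is the distribution of the climate response `α` in the view of firm `i` -/
  belief : Fin n → Measure ℝ

namespace CournotModel

variable {n : ℕ}

/-- Total cost of producing the quantity `q` with technology `r`. -/
def cost (M : CournotModel n) (r q : ℝ) : ℝ :=
  (M.c + (1 - r) * M.d) * q

/-- Temperature increase caused by the total carbon `K` if the climate response is `α`. -/
def temperature (α K : ℝ) : ℝ :=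
  α * K

/-- Net revenue per unit of good (price minus tax) for a firm with technology `r`, when the total
supply is `Q`, the total carbon is `K`, and the climate response is `α`. -/
def netUnitPrice (M : CournotModel n) (Q K α r : ℝ) : ℝ :=
  inverseDemand M.A Q - M.b * temperature α K * α * r

/-- Realized profit of a firm that chooses `(r, q)` while the other sources supply the quantity
`Qo` and the carbon `Ko`, if the climate response is `α`. -/
def profit (M : CournotModel n) (Qo Ko α r q : ℝ) : ℝ :=
  M.netUnitPrice (q + Qo) (r * q + Ko) α r * q - M.cost r q

/-- Expected profit under the subjective belief of firm `i`. -/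
noncomputable def expectedProfit (M : CournotModel n) (i : Fin n) (Qo Ko r q : ℝ) : ℝ :=
  ∫ α, M.profit Qo Ko α r q ∂(M.belief i)

/-- The expected profit in terms of the second moment of the belief. -/
theorem expectedProfit_eq (M : CournotModel n) (i : Fin n)
    [IsProbabilityMeasure (M.belief i)] (hint : Integrable (fun α : ℝ => α ^ 2) (M.belief i))
    (Qo Ko r q : ℝ) (hQ : q + Qo ≤ M.A) :
    M.expectedProfit i Qo Ko r q =
      (M.A - q - Qo) * q - M.b * (∫ α, α ^ 2 ∂(M.belief i)) * (r * q + Ko) * (r * q)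
        - (M.c + M.d - M.d * r) * q := by
  have h : ∀ α : ℝ, M.profit Qo Ko α r q =
      ((M.A - q - Qo) * q - (M.c + M.d - M.d * r) * q)
        - (M.b * (r * q + Ko) * (r * q)) * α ^ 2 := by
    intro α
    simp only [profit, netUnitPrice, cost, temperature, inverseDemand,
      max_eq_left (sub_nonneg.mpr hQ)]
    ring
  simp only [expectedProfit, h]
  rw [integral_sub (integrable_const _) (hint.const_mul _), integral_const_mul]
  simp
  ring

/-- Quantity supplied by the firms other than `i`, where `s j = (r j, q j)`. -/
def quantityOthers (s : Fin n → ℝ × ℝ) (i : Fin n) : ℝ :=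
  ∑ j ∈ Finset.univ.erase i, (s j).2

/-- Carbon from all sources other than firm `i`, where `s j = (r j, q j)`. -/
def carbonOthers (M : CournotModel n) (s : Fin n → ℝ × ℝ) (i : Fin n) : ℝ :=
  M.Kex + ∑ j ∈ Finset.univ.erase i, (s j).1 * (s j).2

/-- A profile `s` of choices `s i = (r i, q i)` is a Nash equilibrium if `r i ∈ [0, 1]` and
`q i ≥ 0`, with the convention `r i = 0` when `q i = 0`, and every firm's choice maximizes its
expected profit over `[0, 1] × [0, ∞)` given the choices of the other firms. -/
structure IsNashEquilibrium (M : CournotModel n) (s : Fin n → ℝ × ℝ) : Prop where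
  technology_mem : ∀ i, (s i).1 ∈ Set.Icc (0 : ℝ) 1
  quantity_nonneg : ∀ i, 0 ≤ (s i).2
  technology_eq_zero : ∀ i, (s i).2 = 0 → (s i).1 = 0
  optimal : ∀ i, ∀ r ∈ Set.Icc (0 : ℝ) 1, ∀ q : ℝ, 0 ≤ q →
    M.expectedProfit i (quantityOthers s i) (M.carbonOthers s i) r q ≤
      M.expectedProfit i (quantityOthers s i) (M.carbonOthers s i) (s i).1 (s i).2

end CournotModel

/-!
Measure a firm's choice by its carbon `k = r * q` and its quantity `q`, so that the strategy set
becomes the cone `0 ≤ k ≤ q`, on which the expected profit (below the choke point of demand) is a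
concave quadratic. Its first-order conditions involve the other firms only through the total
quantity `Q` and the total carbon `K`, own contribution included; they are the complementarity
problem `IsResponse` in `k` and in the clean quantity `q - k`, with `a = A - c - d - Q` and
`β = b * E[α²]`. A profile is an equilibrium if and only if every firm solves this problem at the
aggregates that the profile generates (`IsNashEquilibrium.isResponse`,
`isNashEquilibrium_of_isResponse`). The kink of the demand is harmless: a firm producing
beyond it makes a loss, so supply stays below `A` in equilibrium.

Uniqueness is a monotonicity argument. The responses `q` and `k` both decrease when `Q` and `K`
increase (`IsResponse.quantity_antitone`, `IsResponse.carbon_antitone`), so two equilibria cannot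
have strictly ordered aggregates. The clean quantity `q - k` decreases in `Q` but increases in `K`
(`IsResponse.clean_monotone`), which excludes a larger `Q` together with a smaller `K`: the
clean total `Q - K` would have to rise and fall at the same time. Hence the aggregates, and with
them the individual choices, are unique.

For existence the response is written down explicitly. The intermediate value theorem gives, for
each `K`, a consistent total quantity `Q(K)`, which is Lipschitz in `K` by monotonicity; a second
application of the theorem finds `K`.
-/

/-! ### The response of a firm to the aggregates -/

/-- The first-order conditions of a firm that emits the carbon `k` and produces the quantity `q`,
given the total carbon `K` and the unit margin `a` of the emission-free technology, that is, the
market price minus its unit cost (`a = A - c - d - Q` for total supply `Q`). The variables of the complementarity problem are `k` and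
the clean quantity `q - k`; both `K` and `Q` include the firm's own contribution. -/
structure IsResponse (β d a K k q : ℝ) : Prop where
  carbon_nonneg : 0 ≤ k
  carbon_le : k ≤ q
  le_quantity : a ≤ q
  clean_compl : (q - k) * (q - a) = 0
  le_dirty : a + d ≤ q + β * (K + k)
  dirty_compl : k * (q + β * (K + k) - (a + d)) = 0

namespace IsResponse

variable {β d a a' K K' k k' q q' : ℝ}

theorem quantity_eq_of_lt (h : IsResponse β d a K k q) (hk : k < q) : q = a := by
  rcases mul_eq_zero.1 h.clean_compl with h | h <;> linarith

theorem dirty_eq_of_pos (h : IsResponse β d a K k q) (hk : 0 < k) :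
    q + β * (K + k) = a + d := by
  rcases mul_eq_zero.1 h.dirty_compl with h | h <;> linarith

theorem quantity_antitone (hβ : 0 ≤ β) (h : IsResponse β d a K k q)
    (h' : IsResponse β d a' K' k' q') (ha : a' ≤ a) (hK : K ≤ K') : q' ≤ q := by
  by_contra! hq
  rcases h'.carbon_le.lt_or_eq with hk | hk
  · have := h'.quantity_eq_of_lt hk
    linarith [h.le_quantity]
  · have := h'.dirty_eq_of_pos (by linarith [h.carbon_nonneg, h.carbon_le])
    have := mul_le_mul_of_nonneg_left
      (show K + k ≤ K' + k' by linarith [h.carbon_le]) hβ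
    linarith [h.le_dirty]

theorem carbon_antitone (hβ : 0 ≤ β) (hd : 0 < d) (h : IsResponse β d a K k q)
    (h' : IsResponse β d a' K' k' q') (ha : a' ≤ a) (hK : K ≤ K') : k' ≤ k := by
  have hq := quantity_antitone hβ h h' ha hK
  by_contra! hk
  rcases h.carbon_le.lt_or_eq with hy | hy
  · have := h.quantity_eq_of_lt hy
    have := h'.dirty_eq_of_pos (by linarith [h.carbon_nonneg])
    have h1 : d ≤ β * (K + k) := by linarith [h.le_dirty]
    have h2 : β * (K' + k') ≤ d := by linarith [h'.le_quantity]
    have hβ' : 0 < β := hβ.lt_of_ne (by rintro rfl; linarith)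
    have := mul_lt_mul_of_pos_left (show K + k < K' + k' by linarith) hβ'
    linarith
  · linarith [h'.carbon_le]

/-- The clean quantity falls when the total supply rises and the total carbon falls. -/
theorem clean_monotone (hβ : 0 ≤ β) (hd : 0 < d) (h : IsResponse β d a K k q)
    (h' : IsResponse β d a' K' k' q') (ha : a' ≤ a) (hK : K' ≤ K) : q' - k' ≤ q - k := by
  by_contra! hy
  have hq' := h'.quantity_eq_of_lt (by linarith [h.carbon_le])
  have := h.le_quantity
  have hk : k' < k := by linarith
  have := h.dirty_eq_of_pos (by linarith [h'.carbon_nonneg])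
  have h1 : β * (K + k) ≤ d := by linarith
  have h2 : d ≤ β * (K' + k') := by linarith [h'.le_dirty]
  have hβ' : 0 < β := hβ.lt_of_ne (by rintro rfl; linarith)
  have := mul_lt_mul_of_pos_left (show K' + k' < K + k by linarith) hβ'
  linarith

end IsResponse

/-- The quantity that solves `IsResponse`. -/
noncomputable def responseQuantity (β d a K : ℝ) : ℝ :=
  max (max 0 a) ((a + d - β * K) / (1 + β))

/-- The carbon that solves `IsResponse`; an untaxed firm (`β = 0`) uses only the dirty
technology. -/
noncomputable def responseCarbon (β d a K : ℝ) : ℝ :=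
  if β = 0 then responseQuantity β d a K
  else min (responseQuantity β d a K) (max (d / β - K) 0)

theorem responseQuantity_nonneg (β d a K : ℝ) : 0 ≤ responseQuantity β d a K :=
  (le_max_left 0 a).trans (le_max_left _ _)

theorem isResponse_response {β d a K : ℝ} (hβ : 0 ≤ β) (hd : 0 < d) :
    IsResponse β d a K (responseCarbon β d a K) (responseQuantity β d a K) := by
  have hq0 := responseQuantity_nonneg β d a K
  have hqa : a ≤ responseQuantity β d a K := (le_max_right 0 a).trans (le_max_left _ _)
  have hqe : (a + d - β * K) / (1 + β) ≤ responseQuantity β d a K := le_max_right _ _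
  have hcase : responseQuantity β d a K = 0 ∨ responseQuantity β d a K = a ∨
      responseQuantity β d a K = (a + d - β * K) / (1 + β) := by
    unfold responseQuantity
    rcases max_choice (max 0 a) ((a + d - β * K) / (1 + β)) with h | h
    · rcases max_choice 0 a with h' | h' <;> rw [h, h'] <;> simp
    · rw [h]; simp
  rw [div_le_iff₀ (by linarith)] at hqe
  rw [eq_div_iff (by linarith)] at hcase
  unfold responseCarbon
  generalize responseQuantity β d a K = q at *
  split_ifs with h0
  · subst h0
    refine ⟨hq0, le_rfl, hqa, by simp, by linarith, ?_⟩
    rcases hcase with h | h | h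
    · simp [h]
    · linarith
    · rw [mul_eq_zero]; right; linarith
  · have hβ' : 0 < β := hβ.lt_of_ne' h0
    have hm : β * (d / β) = d := by field_simp
    generalize d / β = z at *
    subst hm
    rcases le_total q (max (z - K) 0) with hk | hk
    · rw [min_eq_left hk]
      refine ⟨hq0, le_rfl, hqa, by simp, by linarith, ?_⟩
      rcases hq0.eq_or_lt with h | h
      · simp [← h]
      · have hz : q ≤ z - K := by
          rcases le_max_iff.1 hk with h' | h' <;> linarith
        have := mul_le_mul_of_nonneg_left hz hβ
        rw [mul_eq_zero]; right
        rcases hcase with h' | h' | h'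
        · linarith
        · linarith
        · linarith
    · rw [min_eq_right hk]
      obtain ⟨hz, hq0'⟩ := max_le_iff.1 hk
      have hz' := mul_le_mul_of_nonneg_left hz hβ
      have hm0 : z - K ≤ max (z - K) 0 := le_max_left _ _
      have hm1 := mul_le_mul_of_nonneg_left hm0 hβ
      refine ⟨le_max_right _ _, hk, hqa, ?_, by linarith, ?_⟩
      · rw [mul_eq_zero]
        rcases hcase with h | h | h
        · left; have := le_max_right (z - K) 0; linarith
        · right; linarith
        · rcases hqa.eq_or_lt with h' | h'
          · right; linarith
          · left
            have : q ≤ z - K := by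
              by_contra! hc
              have := mul_lt_mul_of_pos_left hc hβ'
              linarith
            linarith
      · rcases le_total (z - K) 0 with h | h
        · simp [max_eq_right h]
        · rw [max_eq_left h, mul_eq_zero]
          rcases h.eq_or_lt with h1 | h1
          · left; exact h1.symm
          right
          rcases hcase with h' | h' | h'
          · linarith
          · linarith
          · have : q = a := by
              refine le_antisymm ?_ hqa
              linarith
            linarith

theorem continuous_responseQuantity {β d : ℝ} (hβ : 0 ≤ β) :
    Continuous fun p : ℝ × ℝ => responseQuantity β d p.1 p.2 := by
  have : 1 + β ≠ 0 := by linarith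
  unfold responseQuantity
  fun_prop

theorem continuous_responseCarbon {β d : ℝ} (hβ : 0 ≤ β) :
    Continuous fun p : ℝ × ℝ => responseCarbon β d p.1 p.2 := by
  have := continuous_responseQuantity (d := d) hβ
  unfold responseCarbon
  split_ifs
  · exact this
  · fun_prop

theorem responseQuantity_le {β d a K B : ℝ} (hβ : 0 ≤ β) (hd : 0 ≤ d) (hK : 0 ≤ K) (hB : 0 ≤ B)
    (ha : a + d ≤ B) : responseQuantity β d a K ≤ B := by
  refine max_le (max_le hB (by linarith)) ?_
  rw [div_le_iff₀ (by linarith)]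
  nlinarith [mul_nonneg hβ hK, mul_nonneg hβ hB]

/-- In the carbon argument the response falls with slope at most one, since `β / (1 + β) ≤ 1`. -/
theorem responseQuantity_le_add {β d a K K' : ℝ} (hβ : 0 ≤ β) (hK : K ≤ K') :
    responseQuantity β d a K ≤ responseQuantity β d a K' + (K' - K) := by
  have h1 : max 0 a ≤ responseQuantity β d a K' := le_max_left _ _
  have h2 : (a + d - β * K') / (1 + β) ≤ responseQuantity β d a K' := le_max_right _ _
  refine max_le (by linarith) ?_
  rw [div_le_iff₀ (by linarith)] at h2 ⊢
  nlinarith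

/-! ### Aggregate consistency -/

section Aggregates

variable {ι : Type*} [Fintype ι] {β : ι → ℝ} {d : ℝ}

/-- For every level `K` of total carbon some total quantity is the sum of the responses to it. -/
theorem exists_total_quantity (hβ : ∀ i, 0 ≤ β i) (hd : 0 < d) {m K : ℝ} (hK : 0 ≤ K) :
    ∃ Q, 0 ≤ Q ∧ ∑ i, responseQuantity (β i) d (m - Q) K = Q := by
  set B := Fintype.card ι * max 0 (m + d) with hB
  have hB0 : 0 ≤ B := by positivity
  have hc : Continuous fun Q => (∑ i, responseQuantity (β i) d (m - Q) K) - Q := by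
    refine (continuous_finsetSum _ fun i _ => ?_).sub continuous_id
    exact (continuous_responseQuantity (hβ i)).comp
      (by fun_prop : Continuous fun Q : ℝ => (m - Q, K))
  obtain ⟨Q, hQ, h⟩ := intermediate_value_Icc' hB0 hc.continuousOn (show (0 : ℝ) ∈ _ by
    refine ⟨?_, ?_⟩
    · have : ∑ i, responseQuantity (β i) d (m - B) K ≤ B := by
        refine (Finset.sum_le_card_nsmul _ _ (max 0 (m + d)) fun i _ => ?_).trans ?_
        · exact responseQuantity_le (hβ i) hd.le hK (le_max_left _ _)
            (by linarith [le_max_right 0 (m + d)])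
        · simp [hB]
      linarith
    · have := Finset.sum_nonneg fun i (_ : i ∈ Finset.univ) =>
        responseQuantity_nonneg (β i) d (m - 0) K
      linarith)
  exact ⟨Q, hQ.1, by linarith⟩

theorem exists_aggregates (hβ : ∀ i, 0 ≤ β i) (hd : 0 < d) {m K₀ : ℝ} (hK₀ : 0 ≤ K₀) :
    ∃ Q K, ∑ i, responseQuantity (β i) d (m - Q) K = Q ∧
      K₀ + ∑ i, responseCarbon (β i) d (m - Q) K = K := by
  choose! Q hQ0 hQ using fun (K : ℝ) (hK : 0 ≤ K) => exists_total_quantity (m := m) hβ hd hK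
  have hanti : ∀ K K', 0 ≤ K → K ≤ K' → Q K' ≤ Q K := by
    intro K K' hK hKK
    by_contra! hlt
    have := Finset.sum_le_sum fun i (_ : i ∈ Finset.univ) =>
      (isResponse_response (a := m - Q K) (K := K) (hβ i) hd).quantity_antitone (hβ i)
        (isResponse_response (a := m - Q K') (K := K') (hβ i) hd) (by linarith) hKK
    rw [hQ K hK, hQ K' (hK.trans hKK)] at this
    linarith
  have hlip : ∀ K K', 0 ≤ K → K ≤ K' → Q K - Q K' ≤ Fintype.card ι * (K' - K) := by
    intro K K' hK hKK
    have hle := hanti K K' hK hKK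
    have := Finset.sum_le_sum fun i (_ : i ∈ Finset.univ) =>
      ((isResponse_response (a := m - Q K') (K := K) (hβ i) hd).quantity_antitone (hβ i)
        (isResponse_response (a := m - Q K) (K := K) (hβ i) hd) (by linarith) le_rfl).trans
      (responseQuantity_le_add (hβ i) hKK)
    rw [hQ K hK, Finset.sum_add_distrib, hQ K' (hK.trans hKK)] at this
    simp at this
    linarith
  have hQc : ContinuousOn Q (Set.Ici 0) := by
    refine LipschitzOnWith.continuousOn (K := Fintype.card ι) ?_
    refine LipschitzOnWith.of_dist_le_mul fun K hK K' hK' => ?_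
    rw [Set.mem_Ici] at hK hK'
    simp only [Real.dist_eq, NNReal.coe_natCast]
    rcases le_total K K' with h | h
    · rw [abs_of_nonneg (sub_nonneg.2 (hanti K K' hK h)), abs_sub_comm,
        abs_of_nonneg (sub_nonneg.2 h)]
      exact hlip K K' hK h
    · rw [abs_sub_comm, abs_of_nonneg (sub_nonneg.2 (hanti K' K hK' h)),
        abs_of_nonneg (sub_nonneg.2 h)]
      exact hlip K' K hK' h
  set B := K₀ + Fintype.card ι * max 0 (m + d) with hB
  have hKB : K₀ ≤ B := by rw [hB]; linarith [show 0 ≤ Fintype.card ι * max 0 (m + d) by positivity]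
  have hc : ContinuousOn (fun K => K₀ + (∑ i, responseCarbon (β i) d (m - Q K) K) - K)
      (Set.Icc K₀ B) := by
    refine (continuousOn_const.add (continuousOn_finsetSum _ fun i _ => ?_)).sub continuousOn_id
    exact (continuous_responseCarbon (hβ i)).comp_continuousOn
      (f := fun K => (m - Q K, K)) ((continuousOn_const.sub
        (hQc.mono fun x hx => hK₀.trans hx.1)).prodMk continuousOn_id)
  obtain ⟨K, hK, h⟩ := intermediate_value_Icc' hKB hc (show (0 : ℝ) ∈ _ by
    refine ⟨?_, ?_⟩
    · have : ∑ i, responseCarbon (β i) d (m - Q B) B ≤ Fintype.card ι * max 0 (m + d) := by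
        refine (Finset.sum_le_card_nsmul _ _ (max 0 (m + d)) fun i _ => ?_).trans ?_
        · exact (isResponse_response (hβ i) hd).carbon_le.trans <|
            responseQuantity_le (hβ i) hd.le (hK₀.trans hKB) (le_max_left _ _)
              (by linarith [le_max_right 0 (m + d), hQ0 B (hK₀.trans hKB)])
        · simp
      linarith
    · have := Finset.sum_nonneg fun i (_ : i ∈ Finset.univ) =>
        (isResponse_response (a := m - Q K₀) (K := K₀) (hβ i) hd).carbon_nonneg
      linarith)
  exact ⟨Q K, K, hQ K (hK₀.trans hK.1), by linarith⟩

/-- Either the aggregates are ordered in the same direction and the antitone responses force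
equality, or they move in opposite directions, against the monotonicity of the clean quantities. -/
theorem aggregates_unique (hβ : ∀ i, 0 ≤ β i) (hd : 0 < d) {m K₀ : ℝ} {k k' q q' : ι → ℝ}
    (h : ∀ i, IsResponse (β i) d (m - ∑ j, q j) (K₀ + ∑ j, k j) (k i) (q i))
    (h' : ∀ i, IsResponse (β i) d (m - ∑ j, q' j) (K₀ + ∑ j, k' j) (k' i) (q' i)) :
    k = k' ∧ q = q' := by
  wlog hQ : ∑ j, q j ≤ ∑ j, q' j generalizing k k' q q'
  · have := this h' h (le_of_not_ge hQ)
    exact ⟨this.1.symm, this.2.symm⟩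
  rcases lt_or_ge (∑ j, k' j) (∑ j, k j) with hK | hK
  · have := Finset.sum_le_sum fun i (_ : i ∈ Finset.univ) =>
      (h i).clean_monotone (hβ i) hd (h' i) (by linarith) (by linarith)
    simp only [Finset.sum_sub_distrib] at this
    linarith
  · have h1 := fun i => (h i).quantity_antitone (hβ i) (h' i) (by linarith) (by linarith)
    have h2 := fun i => (h i).carbon_antitone (hβ i) hd (h' i) (by linarith) (by linarith)
    have h3 := Finset.sum_le_sum fun i (_ : i ∈ Finset.univ) => h1 i
    have h4 := Finset.sum_le_sum fun i (_ : i ∈ Finset.univ) => h2 i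
    refine ⟨funext fun i => le_antisymm ?_ (h2 i), funext fun i => le_antisymm ?_ (h1 i)⟩
    · exact (h' i).carbon_antitone (hβ i) hd (h i) (by linarith) (by linarith)
    · exact (h' i).quantity_antitone (hβ i) (h i) (by linarith) (by linarith)

end Aggregates

/-! ### Optimality for a single firm -/

/-- The expected profit as a function of the carbon `k` and the quantity `q`, when the other sources
supply `Qo` and `Ko`; `e` is the unit cost of the dirty technology and `d` the premium of the
clean one. -/
def carbonProfit (A e d β Qo Ko k q : ℝ) : ℝ :=
  max (A - (q + Qo)) 0 * q - β * (k + Ko) * k - (e + d) * q + d * k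

theorem nonpos_of_forall_mul_le_sq {g C ε : ℝ} (hε : 0 < ε) (hC : 0 ≤ C)
    (h : ∀ t, 0 < t → t ≤ ε → t * g ≤ C * t ^ 2) : g ≤ 0 := by
  by_contra! hg
  have ht : 0 < min ε (g / (C + 1)) := lt_min hε (by positivity)
  have h1 := h _ ht (min_le_left _ _)
  have h2 : min ε (g / (C + 1)) * (C + 1) ≤ g :=
    (le_div_iff₀ (by linarith)).1 (min_le_right _ _)
  generalize min ε (g / (C + 1)) = t at *
  have : t * g ≤ t * (C * t) := by linarith
  linarith [le_of_mul_le_mul_left this ht]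

/-- A maximizer below the choke point of demand has no profitable feasible direction `(u, v)`. -/
theorem directional_nonpos {A e d β Qo Ko k q u v ε : ℝ} (hβ : 0 ≤ β) (hQ : q + Qo < A)
    (hopt : ∀ k' q', 0 ≤ k' → k' ≤ q' →
      carbonProfit A e d β Qo Ko k' q' ≤ carbonProfit A e d β Qo Ko k q)
    (hε : 0 < ε) (hfeas : ∀ t, 0 < t → t ≤ ε → 0 ≤ k + t * u ∧ k + t * u ≤ q + t * v) :
    v * (A - e - d - (q + Qo) - q) + u * (d - β * ((k + Ko) + k)) ≤ 0 := by
  have hv : 0 < (A - (q + Qo)) / (|v| + 1) := div_pos (by linarith) (by positivity)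
  refine nonpos_of_forall_mul_le_sq (lt_min hε hv) (C := v ^ 2 + β * u ^ 2) (by positivity) ?_
  intro t ht htε
  obtain ⟨h1, h2⟩ := hfeas t ht (htε.trans (min_le_left _ _))
  have h3 := (le_div_iff₀ (by positivity)).1 (htε.trans (min_le_right _ _))
  have h4 : t * v ≤ t * |v| := mul_le_mul_of_nonneg_left (le_abs_self v) ht.le
  have h := hopt _ _ h1 h2
  unfold carbonProfit at h
  rw [max_eq_left (by linarith), max_eq_left (by linarith)] at h
  linarith

theorem isResponse_of_optimal {A e d β Qo Ko k q : ℝ} (hβ : 0 ≤ β) (hQ : q + Qo < A)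
    (hk : 0 ≤ k) (hkq : k ≤ q)
    (hopt : ∀ k' q', 0 ≤ k' → k' ≤ q' →
      carbonProfit A e d β Qo Ko k' q' ≤ carbonProfit A e d β Qo Ko k q) :
    IsResponse β d (A - e - d - (q + Qo)) (k + Ko) k q := by
  have h1 := directional_nonpos (u := 0) (v := 1) hβ hQ hopt one_pos
    fun t _ _ => ⟨by linarith, by linarith⟩
  have h2 := directional_nonpos (u := 1) (v := 1) hβ hQ hopt one_pos
    fun t _ _ => ⟨by linarith, by linarith⟩
  refine ⟨hk, hkq, by linarith, ?_, by linarith, ?_⟩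
  · rcases hkq.eq_or_lt with h | h
    · simp [h]
    · have h3 := directional_nonpos (u := 0) (v := -1) hβ hQ hopt (sub_pos.2 h)
        fun t _ _ => ⟨by linarith, by linarith⟩
      rw [mul_eq_zero]; right; linarith
  · rcases hk.eq_or_lt with h | h
    · simp [← h]
    · have h3 := directional_nonpos (u := -1) (v := -1) hβ hQ hopt h
        fun t _ _ => ⟨by linarith, by linarith⟩
      rw [mul_eq_zero]; right; linarith

theorem carbonProfit_neg {A e d β Qo Ko k q : ℝ} (he : 0 < e) (hd : 0 ≤ d) (hβ : 0 ≤ β)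
    (hKo : 0 ≤ Ko) (hk : 0 ≤ k) (hkq : k ≤ q) (hq : 0 < q) (hA : A - e < q + Qo) :
    carbonProfit A e d β Qo Ko k q < 0 := by
  unfold carbonProfit
  have h1 : max (A - (q + Qo)) 0 < e := max_lt (by linarith) he
  have h2 := mul_lt_mul_of_pos_right h1 hq
  have h3 : 0 ≤ β * (k + Ko) * k := by positivity
  have h4 := mul_le_mul_of_nonneg_left hkq hd
  linarith

theorem optimal_of_isResponse {A e d β Qo Ko k q : ℝ} (he : 0 < e) (hd : 0 ≤ d) (hβ : 0 ≤ β)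
    (hQ : q + Qo ≤ A) (hKo : 0 ≤ Ko)
    (h : IsResponse β d (A - e - d - (q + Qo)) (k + Ko) k q) {k' q' : ℝ}
    (hk' : 0 ≤ k') (hkq' : k' ≤ q') :
    carbonProfit A e d β Qo Ko k' q' ≤ carbonProfit A e d β Qo Ko k q := by
  -- Below the choke point the profit is concave, so the first-order conditions suffice.
  have key : ∀ k' q', 0 ≤ k' → k' ≤ q' → q' + Qo ≤ A →
      carbonProfit A e d β Qo Ko k' q' ≤ carbonProfit A e d β Qo Ko k q := by
    intro k' q' hk' hkq' hQ'
    unfold carbonProfit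
    rw [max_eq_left (by linarith), max_eq_left (by linarith)]
    have h1 := mul_nonneg (sub_nonneg.2 hkq') (sub_nonneg.2 h.le_quantity)
    have h2 := mul_nonneg hk' (sub_nonneg.2 h.le_dirty)
    have h3 := h.clean_compl
    have h4 := h.dirty_compl
    have h5 := sq_nonneg (q' - q)
    have h6 := mul_nonneg hβ (sq_nonneg (k' - k))
    linarith
  rcases le_or_gt (q' + Qo) A with hA | hA
  · exact key k' q' hk' hkq' hA
  · have h0 : carbonProfit A e d β Qo Ko 0 0 = 0 := by simp [carbonProfit]
    have hq : 0 ≤ q := h.carbon_nonneg.trans h.carbon_le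
    have := key 0 0 le_rfl le_rfl (by linarith)
    have := carbonProfit_neg (A := A) (Qo := Qo) he hd hβ hKo hk' hkq' (by linarith) (by linarith)
    linarith

/-! ### Equilibria as consistent responses -/

namespace CournotModel

variable {n : ℕ} (M : CournotModel n)

/-- The tax coefficient times the second moment of the belief of firm `i`. -/
noncomputable def taxWeight (i : Fin n) : ℝ :=
  M.b * ∫ α, α ^ 2 ∂(M.belief i)

theorem taxWeight_nonneg (hb : 0 ≤ M.b) (i : Fin n) : 0 ≤ M.taxWeight i :=
  mul_nonneg hb (integral_nonneg fun _ => sq_nonneg _)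

theorem expectedProfit_eq_carbonProfit (i : Fin n) [IsProbabilityMeasure (M.belief i)]
    (hint : Integrable (fun α : ℝ => α ^ 2) (M.belief i)) (Qo Ko r q : ℝ) :
    M.expectedProfit i Qo Ko r q =
      carbonProfit M.A M.c M.d (M.taxWeight i) Qo Ko (r * q) q := by
  have h : ∀ α : ℝ, M.profit Qo Ko α r q =
      (max (M.A - (q + Qo)) 0 * q - (M.c + (1 - r) * M.d) * q)
        - (M.b * (r * q + Ko) * (r * q)) * α ^ 2 := by
    intro α
    simp only [profit, netUnitPrice, cost, temperature, inverseDemand]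
    ring
  simp only [expectedProfit, h, taxWeight, carbonProfit]
  rw [integral_sub (integrable_const _) (hint.const_mul _), integral_const_mul]
  simp
  ring

theorem add_quantityOthers (s : Fin n → ℝ × ℝ) (i : Fin n) :
    (s i).2 + quantityOthers s i = ∑ j, (s j).2 :=
  Finset.add_sum_erase _ (fun j => (s j).2) (Finset.mem_univ i)

theorem add_carbonOthers (s : Fin n → ℝ × ℝ) (i : Fin n) :
    (s i).1 * (s i).2 + M.carbonOthers s i = M.Kex + ∑ j, (s j).1 * (s j).2 := by
  rw [← Finset.add_sum_erase _ (fun j => (s j).1 * (s j).2) (Finset.mem_univ i), carbonOthers]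
  ring

variable {M} {s : Fin n → ℝ × ℝ}

theorem carbonOthers_nonneg (hK : 0 ≤ M.Kex) (h : ∀ i, 0 ≤ (s i).1 * (s i).2) (i : Fin n) :
    0 ≤ M.carbonOthers s i :=
  add_nonneg hK (Finset.sum_nonneg fun j _ => h j)

theorem IsNashEquilibrium.isResponse (hA : 0 < M.A) (hc : 0 < M.c) (hd : 0 < M.d) (hb : 0 ≤ M.b)
    (hK : 0 ≤ M.Kex) (hprob : ∀ i, IsProbabilityMeasure (M.belief i))
    (hmoment : ∀ i, Integrable (fun α : ℝ => α ^ 2) (M.belief i))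
    (hs : M.IsNashEquilibrium s) (i : Fin n) :
    IsResponse (M.taxWeight i) M.d (M.A - M.c - M.d - ∑ j, (s j).2)
      (M.Kex + ∑ j, (s j).1 * (s j).2) ((s i).1 * (s i).2) (s i).2 := by
  have hk0 : ∀ i, 0 ≤ (s i).1 * (s i).2 := fun i =>
    mul_nonneg (hs.technology_mem i).1 (hs.quantity_nonneg i)
  have hkq : ∀ i, (s i).1 * (s i).2 ≤ (s i).2 := fun i =>
    mul_le_of_le_one_left (hs.quantity_nonneg i) (hs.technology_mem i).2
  have hopt : ∀ i k q, 0 ≤ k → k ≤ q →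
      carbonProfit M.A M.c M.d (M.taxWeight i) (quantityOthers s i) (M.carbonOthers s i) k q ≤
      carbonProfit M.A M.c M.d (M.taxWeight i) (quantityOthers s i) (M.carbonOthers s i)
        ((s i).1 * (s i).2) (s i).2 := by
    intro i k q hk hkq
    have hq := hk.trans hkq
    have := hs.optimal i (k / q) ⟨div_nonneg hk hq, div_le_one_of_le₀ hkq hq⟩ q hq
    rw [M.expectedProfit_eq_carbonProfit i (hmoment i),
      M.expectedProfit_eq_carbonProfit i (hmoment i),
      div_mul_cancel_of_imp (fun h => by linarith)] at this
    exact this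
  -- An active firm would make a loss if the supply exceeded `A - c`.
  have hQ : ∑ j, (s j).2 < M.A := by
    by_cases h : ∃ j, 0 < (s j).2
    · obtain ⟨j, hj⟩ := h
      by_contra! hlt
      have h1 := hopt j 0 0 le_rfl le_rfl
      have h2 := carbonProfit_neg (A := M.A) (Qo := quantityOthers s j) hc hd.le
        (M.taxWeight_nonneg hb j) (carbonOthers_nonneg hK hk0 j) (hk0 j) (hkq j) hj
        (by rw [add_quantityOthers]; linarith)
      have h0 : carbonProfit M.A M.c M.d (M.taxWeight j) (quantityOthers s j)
        (M.carbonOthers s j) 0 0 = 0 := by simp [carbonProfit]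
      linarith
    · push Not at h
      exact (Finset.sum_nonpos fun j _ => h j).trans_lt hA
  rw [← add_quantityOthers s i, ← M.add_carbonOthers s i]
  exact isResponse_of_optimal (M.taxWeight_nonneg hb i) (by rwa [add_quantityOthers])
    (hk0 i) (hkq i) (hopt i)

/-- The quotient `k / q` is the technology that emits `k`; its value `0` at `q = 0` is the one
required of an inactive firm. -/
theorem isNashEquilibrium_of_isResponse (hA : 0 < M.A) (hc : 0 < M.c) (hd : 0 < M.d)
    (hb : 0 ≤ M.b) (hK : 0 ≤ M.Kex) (hprob : ∀ i, IsProbabilityMeasure (M.belief i))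
    (hmoment : ∀ i, Integrable (fun α : ℝ => α ^ 2) (M.belief i)) {k q : Fin n → ℝ}
    (h : ∀ i, IsResponse (M.taxWeight i) M.d (M.A - M.c - M.d - ∑ j, q j)
      (M.Kex + ∑ j, k j) (k i) (q i)) :
    M.IsNashEquilibrium fun i => (k i / q i, q i) := by
  set s : Fin n → ℝ × ℝ := fun i => (k i / q i, q i) with hs
  have hq0 : ∀ i, 0 ≤ q i := fun i => (h i).carbon_nonneg.trans (h i).carbon_le
  have hkq : ∀ i, (s i).1 * (s i).2 = k i := fun i =>
    div_mul_cancel_of_imp fun h0 => by linarith [(h i).carbon_nonneg, (h i).carbon_le]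
  have hQ : ∑ j, q j ≤ M.A := by
    by_contra! hlt
    have hz : ∀ i, q i = 0 := by
      intro i
      by_contra hne
      have hpos : 0 < q i := (hq0 i).lt_of_ne' hne
      rcases (h i).carbon_le.lt_or_eq with hk | hk
      · linarith [(h i).quantity_eq_of_lt hk]
      · have := (h i).dirty_eq_of_pos (hk ▸ hpos)
        have hsum := Finset.sum_nonneg fun j (_ : j ∈ Finset.univ) => (h j).carbon_nonneg
        have := mul_nonneg (M.taxWeight_nonneg hb i)
          (show 0 ≤ M.Kex + ∑ j, k j + k i by linarith [(h i).carbon_nonneg])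
        linarith
    simp only [hz, Finset.sum_const_zero] at hlt
    linarith
  refine ⟨fun i => ⟨div_nonneg (h i).carbon_nonneg (hq0 i),
    div_le_one_of_le₀ (h i).carbon_le (hq0 i)⟩, hq0, fun i (hi : q i = 0) => ?_, ?_⟩
  · simp [hs, hi]
  · intro i r hr x hx
    rw [M.expectedProfit_eq_carbonProfit i (hmoment i),
      M.expectedProfit_eq_carbonProfit i (hmoment i)]
    have hQi := add_quantityOthers s i
    have hKi := M.add_carbonOthers s i
    simp only [hkq] at hKi ⊢
    refine optimal_of_isResponse hc hd.le (M.taxWeight_nonneg hb i) (hQi.trans_le hQ)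
      (carbonOthers_nonneg hK (fun j => (hkq j).symm ▸ (h j).carbon_nonneg) i) ?_
      (mul_nonneg hr.1 hx) (mul_le_of_le_one_left hx hr.2)
    rw [hQi, hKi]
    exact h i

end CournotModel

/-- In the Cournot model with quadratic consumer utility there is exactly one equilibrium. -/
theorem theorem2p2 {n : ℕ} (M : CournotModel n)
    (hA : 0 < M.A) (hc : 0 < M.c) (hd : 0 < M.d) (hb : 0 ≤ M.b) (hK : 0 ≤ M.Kex)
    (hprob : ∀ i, IsProbabilityMeasure (M.belief i))
    (hmoment : ∀ i, Integrable (fun α : ℝ => α ^ 2) (M.belief i)) :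
    ∃! s : Fin n → ℝ × ℝ, M.IsNashEquilibrium s := by
  have hβ := M.taxWeight_nonneg hb
  obtain ⟨Q, K, hQ, hK'⟩ := exists_aggregates (m := M.A - M.c - M.d) hβ hd hK
  refine existsUnique_of_exists_of_unique ⟨_, CournotModel.isNashEquilibrium_of_isResponse
    hA hc hd hb hK hprob hmoment
    (k := fun i => responseCarbon (M.taxWeight i) M.d (M.A - M.c - M.d - Q) K)
    (q := fun i => responseQuantity (M.taxWeight i) M.d (M.A - M.c - M.d - Q) K) ?_⟩ ?_
  · intro i
    simp only [hQ, hK']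
    exact isResponse_response (hβ i) hd
  · intro s s' hs hs'
    obtain ⟨hk, hq⟩ := aggregates_unique hβ hd
      (hs.isResponse hA hc hd hb hK hprob hmoment) (hs'.isResponse hA hc hd hb hK hprob hmoment)
    funext i
    have hqi : (s i).2 = (s' i).2 := congrFun hq i
    have hki : (s i).1 * (s i).2 = (s' i).1 * (s' i).2 := congrFun hk i
    refine Prod.ext ?_ hqi
    by_cases h0 : (s i).2 = 0
    · rw [hs.technology_eq_zero i h0, hs'.technology_eq_zero i (hqi ▸ h0)]
    · rw [← hqi] at hki
      exact mul_right_cancel₀ h0 hki
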